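/- Let $a,b,c\in\mathbb C^*$, and let $(s_j)_{j\ge 0}$ be a sequence of complex numbers with $s_0\neq 0$ and $$s_j = a\, s_{j-2}+b\sum_{i=0}^{j-2}s_is_{j-2-i}+c\sum_{i=0}^{j-3}s_is_{j-3-i}\qquad (j\ge 2).$$ Let $\Delta_n=\det(s_{i+j})_{0\le i,j\le n-1}$ be its Hankel determinants ($\Delta_0=1$). For $n\ge1$ let $\Delta_n^*$ be the bordered Hankel determinant obtained from $\Delta_n$ by replacing the last column $(s_{n-1},\dots,s_{2n-2})^T$ by $(s_n,\dots,s_{2n-1})^T$, and put $\Delta^*_0=0$. Put $$U=-s_0c-s_1b,\quad F=-a-2s_0b,\quad J=2(s_0ab+s_0^2b^2+s_1c),\quad \alpha=U^2,\quad \beta=\alpha F+\tfrac14J^2,$$ and $x_0=b$, $x_n=\Delta_{n-1}$ and $y_n=\Delta^*_{n-1}$ for $n\ge1$. Then: 1. $(x_n)$ is a Somos-4 sequence: $x_{n+4}x_n=\alpha x_{n+3}x_{n+1}+\beta x_{n+2}^2$ for all $n\ge 0$. 2. $(y_n)_{n\geq 1}$ is a shadow Somos-4 sequence, i.e. for all $n\ge1$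 $$x_ny_{n+4}-\alpha x_{n+1}y_{n+3}-2\beta x_{n+2}y_{n+2}-\alpha x_{n+3}y_{n+1}+x_{n+4}y_n=0 .$$ Moreover, the first integral of the Somos-4 recurrence has the value $J$ with no odd part on it: with the dual numbers $X_n=x_n+y_n\varepsilon$ ($\varepsilon^2=0$), $$J\,X_nX_{n+1}X_{n+2}X_{n+3}=X_n^2X_{n+3}^2+\alpha\,(X_{n+1}^3X_{n+3}+X_nX_{n+2}^3)+\beta\,X_{n+1}^2X_{n+2}^2\qquad(n\ge1).$$ 3. $(y_n)$ is the third shadow sequence up to a multiple of $x_n$. Suppose that $x_n\ne0$ for all $n$. For $u\in\mathbb C$, call a pair of sequences $(v_n)_{n\geq 0}$, $(d_n)_{n\ge1}$ with $d_n=x_{n+1}x_{n-1}/x_n^2$ and $$v_n=-v_{n-1}+u/d_n,\qquad d_{n+1}=-d_n-v_n^2-F\qquad(n\ge1)$$ an associated solution with parameter $u$; the third shadow sequence which it defines is $y_n^{(iii)}=-x_n\sum_{j=0}^{n-1}v_j$. There is an associated solution with parameter $u=U$ such that $$\Delta^*_{n-1}=y_n^{(iii)}+v_0x_n\qquad\text{for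 all } n\ge1 .$$ Moreover, for every $u$ with $u^2=\alpha$ and every associated solution with parameter $u$ there is a sign $\sigma=\pm1$ with $u=\sigma U$ and $\Delta^*_{n-1}=\sigma\,(y_n^{(iii)}+v_0x_n)$ for all $n\ge1$. 4. If $x_2,x_3,x_4\ne0$, and if it is not the case that both $s_0c=s_1b$ and $s_0^2a=s_1^2$, then the sequences $(x_n)$, $(nx_n)$, $(\Delta^*_{n-1})$, $n\ge1$, are linearly independent over $\mathbb C$. -/

import Mathlib

namespace ShadowSomos

/-- The moment recursion
`s_j = a s_{j-2} + b ∑_{i=0}^{j-2} s_i s_{j-2-i} + c ∑_{i=0}^{j-3} s_i s_{j-3-i}` for `j ≥ 2`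
(for `j = 2` the last sum is empty). The values `s_0`, `s_1` are free. -/
def MomentRecursion (a b c : ℂ) (s : ℕ → ℂ) : Prop :=
  ∀ j : ℕ, 2 ≤ j →
    s j = a * s (j - 2)
      + b * ∑ i ∈ Finset.range (j - 1), s i * s (j - 2 - i)
      + c * ∑ i ∈ Finset.range (j - 2), s i * s (j - 3 - i)

/-- The Hankel determinant `Δ_n = det (s_{i+j})`, `0 ≤ i, j < n`; `Δ_0 = 1`. -/
noncomputable def hankelDet (s : ℕ → ℂ) (n : ℕ) : ℂ :=
  Matrix.det (Matrix.of fun i j : Fin n => s ((i : ℕ) + (j : ℕ)))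

/-- The bordered Hankel determinant `Δ*_n`: the `n × n` Hankel matrix whose last column
`(s_{n-1}, …, s_{2n-2})` is replaced by `(s_n, …, s_{2n-1})`; `Δ*_0 = 0`. -/
noncomputable def borderedHankelDet (s : ℕ → ℂ) : ℕ → ℂ
  | 0 => 0
  | n + 1 => Matrix.det (Matrix.of fun i j : Fin (n + 1) =>
      if j = Fin.last n then s ((i : ℕ) + (n + 1)) else s ((i : ℕ) + (j : ℕ)))

/-- `U = - s_0 c - s_1 b`. -/
def paramU (b c : ℂ) (s : ℕ → ℂ) : ℂ := -(s 0 * c) - s 1 * b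

/-- `F = - a - 2 s_0 b`. -/
def paramF (a b : ℂ) (s : ℕ → ℂ) : ℂ := -a - 2 * s 0 * b

/-- `J = 2 (s_0 a b + s_0² b² + s_1 c)`. -/
def paramJ (a b c : ℂ) (s : ℕ → ℂ) : ℂ := 2 * (s 0 * a * b + s 0 ^ 2 * b ^ 2 + s 1 * c)

/-- `α = U²`. -/
def paramAlpha (b c : ℂ) (s : ℕ → ℂ) : ℂ := paramU b c s ^ 2

/-- `β = α F + J² / 4`. -/
noncomputable def paramBeta (a b c : ℂ) (s : ℕ → ℂ) : ℂ :=
  paramAlpha b c s * paramF a b s + paramJ a b c s ^ 2 / 4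

/-- The Somos-4 sequence attached to the moments: `x_n = Δ_{n-1}` for `n ≥ 1`, with `x_0 = b`
(the value at `0` which the Somos-4 relation at `n = 0` forces when `x_4 ≠ 0`). -/
noncomputable def somosSeq (b : ℂ) (s : ℕ → ℂ) : ℕ → ℂ
  | 0 => b
  | n + 1 => hankelDet s n

/-- The Somos-4 relation at `n`. -/
def SomosAt (α β : ℂ) (x : ℕ → ℂ) (n : ℕ) : Prop :=
  x (n + 4) * x n = α * x (n + 3) * x (n + 1) + β * x (n + 2) ^ 2

/-- The homogeneous shadow Somos-4 equation at `n`, that is, the linearization at `x` of the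
Somos-4 relation with `α`, `β` fixed. -/
def ShadowAt (α β : ℂ) (x y : ℕ → ℂ) (n : ℕ) : Prop :=
  x n * y (n + 4) - α * x (n + 1) * y (n + 3) - 2 * β * x (n + 2) * y (n + 2)
    - α * x (n + 3) * y (n + 1) + x (n + 4) * y n = 0

/-- The first integral of Somos-4, with denominator cleared, over an arbitrary commutative
`ℂ`-algebra `R`: the relation
`J X_n X_{n+1} X_{n+2} X_{n+3}
  = X_n² X_{n+3}² + α (X_{n+1}³ X_{n+3} + X_n X_{n+2}³) + β X_{n+1}² X_{n+2}²`. -/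
def FirstIntegralAt {R : Type*} [CommRing R] [Algebra ℂ R] (α β J : ℂ) (X : ℕ → R) (n : ℕ) :
    Prop :=
  algebraMap ℂ R J * (X n * X (n + 1) * X (n + 2) * X (n + 3))
    = X n ^ 2 * X (n + 3) ^ 2
      + algebraMap ℂ R α * (X (n + 1) ^ 3 * X (n + 3) + X n * X (n + 2) ^ 3)
      + algebraMap ℂ R β * (X (n + 1) ^ 2 * X (n + 2) ^ 2)

/-- The dual number `x + y ε`. -/
noncomputable def dual (x y : ℂ) : DualNumber ℂ := TrivSqZeroExt.inl x + TrivSqZeroExt.inr y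

/-- `(v, d)` is a solution, associated with the nowhere vanishing sequence `x_0, x_1, x_2, …`, of
the map `v_n = - v_{n-1} + u / d_n`, `d_{n+1} = - d_n - v_n² - f` with parameters `u`, `f`:
here `d_n = x_{n+1} x_{n-1} / x_n²`, and `n ≥ 1` throughout (`d_0` plays no role). -/
structure AssociatedSolution (u f : ℂ) (x v d : ℕ → ℂ) : Prop where
  d_eq : ∀ n, 1 ≤ n → d n = x (n + 1) * x (n - 1) / x n ^ 2
  v_eq : ∀ n, 1 ≤ n → v n = -v (n - 1) + u / d n
  d_succ : ∀ n, 1 ≤ n → d (n + 1) = -d n - v n ^ 2 - f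

/-- The third shadow sequence `y_n = - x_n ∑_{j=0}^{n-1} v_j`. -/
def thirdShadow (x v : ℕ → ℂ) (n : ℕ) : ℂ := -(x n * ∑ j ∈ Finset.range n, v j)

end ShadowSomos

/-! The proof is a descent along the Jacobi continued fraction of the moment generating function
`G`. The recursion is a quadratic equation for `G`; writing `G = s_0 / (1 - v X - X² T)` with `v =
s_1 / s_0` gives a quadratic equation of the same shape for `T`, with `(a, b, c)` replaced by `(2v²
- a, 1, v)` (`MomentRec.exists_step`). The quantities `U`, `F` and `J = 2h` do not change.

Column operations show that passing from `s` to the moments `t` of `T` shifts the index of `x` and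
`y`, up to the gauge `x_m ↦ r^m x_m`, `y ↦ y + v x` (`JacobiStep.hankelSeq_succ`,
`JacobiStep.borderSeq_succ`). The initial values `x_0 = b`, `y_0 = -c` are chosen so that this
includes the first index. The relations in `Identities` respect the gauge, so each follows from its
case `n = 0`, a polynomial identity in `a, b, c, s_0, s_1`. Vanishing determinants would stop the
descent; `MomentRec.identities` avoids them by a one-parameter deformation.

With `v_n = y_n / x_n - y_{n+1} / x_{n+1}`, the relations `linear` and `quadratic` are exactly the
map for `(v_n, d_n)`, which identifies the third shadow sequence. -/

namespace ShadowSomos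

/-! ### Hankel determinants under one continued fraction step -/

section Hankel

variable {R : Type*} [CommRing R]

/-- The Hankel matrix of size `n` of a sequence in a commutative ring. -/
def hankelMatrix (s : ℕ → R) (n : ℕ) : Matrix (Fin n) (Fin n) R :=
  Matrix.of fun i j => s ((i : ℕ) + (j : ℕ))

/-- The determinant of the Hankel matrix of size `n + 1` whose last column is replaced by `w`. -/
def hankelBorder (s : ℕ → R) (n : ℕ) (w : ℕ → R) : R :=
  (Matrix.of fun i j : Fin (n + 1) =>
    if j = Fin.last n then w i else s ((i : ℕ) + (j : ℕ))).det

theorem hankelBorder_eq_cramer (s : ℕ → R) (n : ℕ) (w : ℕ → R) :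
    hankelBorder s n w
      = (hankelMatrix s (n + 1)).cramer (fun i => w i) (Fin.last n) := by
  rw [Matrix.cramer_apply, hankelBorder]
  congr 1
  ext i j
  by_cases h : j = Fin.last n <;> simp [h, hankelMatrix]

theorem hankelBorder_self (s : ℕ → R) (n : ℕ) :
    hankelBorder s n (fun i => s (i + n)) = (hankelMatrix s (n + 1)).det := by
  rw [hankelBorder]
  congr 1
  ext i j
  by_cases h : j = Fin.last n <;> simp [h, hankelMatrix]

theorem hankelBorder_add (s : ℕ → R) (n : ℕ) (w z : ℕ → R) :
    hankelBorder s n (fun i => w i + z i) = hankelBorder s n w + hankelBorder s n z := by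
  simp only [hankelBorder_eq_cramer]
  rw [← Pi.add_apply, ← map_add]
  rfl

theorem hankelBorder_smul (s : ℕ → R) (n : ℕ) (r : R) (w : ℕ → R) :
    hankelBorder s n (fun i => r * w i) = r * hankelBorder s n w := by
  simp only [hankelBorder_eq_cramer]
  rw [← smul_eq_mul, ← Pi.smul_apply, ← map_smul]
  rfl

theorem hankelBorder_column (s : ℕ → R) {n l : ℕ} (hl : l < n) :
    hankelBorder s n (fun i => s (i + l)) = 0 := by
  refine Matrix.det_zero_of_column_eq (i := ⟨l, by omega⟩) (j := Fin.last n) ?_ ?_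
  · simp [Fin.ext_iff]; omega
  · intro i
    have : (⟨l, by omega⟩ : Fin (n + 1)) ≠ Fin.last n := by simp [Fin.ext_iff]; omega
    simp [this]

theorem hankelBorder_columns (s : ℕ → R) (n : ℕ) (r : ℕ → R) :
    ∀ m ≤ n, hankelBorder s n (fun i => ∑ l ∈ Finset.range m, s (i + l) * r l) = 0 := by
  intro m
  induction m with
  | zero => intro _; simpa using hankelBorder_smul s n 0 (fun _ => 0)
  | succ m ih =>
    intro hm
    simp only [Finset.sum_range_succ]
    rw [hankelBorder_add, ih (by omega)]
    have := hankelBorder_smul s n (r m) (fun i => s (i + m))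
    rw [hankelBorder_column s (by omega)] at this
    simp only [mul_comm _ (r m), this]
    simp

/-- `s` and `t` are the moments of two consecutive tails of a Jacobi continued fraction:
as power series, `S (1 - v X - X² T) = s_0`. -/
def JacobiStep (v : R) (s t : ℕ → R) : Prop :=
  ∀ m, s (m + 1) = v * s m + ∑ k ∈ Finset.range m, s (m - 1 - k) * t k

/-- The convolution is cut at `k = n`: the terms below the cut are multiples of earlier Hankel
columns, which a determinant does not see, and the others are a convolution with a Hankel column of
`t`. -/
theorem JacobiStep.column {v : R} {s t : ℕ → R} (h : JacobiStep v s t) (i n : ℕ) :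
    s (i + (n + 1)) = v * s (i + n) + ∑ l ∈ Finset.range n, s (i + l) * t (n - 1 - l)
      + ∑ k ∈ Finset.range i, s (i - 1 - k) * t (k + n) := by
  rw [← add_assoc, h (i + n), add_comm i n, Finset.sum_range_add, add_assoc]
  congr 2
  · rw [← Finset.sum_range_reflect]
    refine Finset.sum_congr rfl fun l hl => ?_
    have := Finset.mem_range.1 hl
    congr 2; omega
  · refine Finset.sum_congr rfl fun l hl => ?_
    have := Finset.mem_range.1 hl
    rw [add_comm n l]
    congr 2; omega

/-- The coefficients of `1 - v X - X² T`. -/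
def stepDenom (v : R) (t : ℕ → R) : ℕ → R
  | 0 => 1
  | 1 => -v
  | k + 2 => -t k

/-- In `S (1 - v X - X² T) = s_0` the coefficient of `X^(i+n+1)` is zero. The left side is its part
with moments of index at least `i`, the right side minus the rest. -/
theorem JacobiStep.sum_stepDenom {v : R} {s t : ℕ → R} (h : JacobiStep v s t) (i n : ℕ) :
    ∑ l ∈ Finset.range (n + 2), s (i + l) * stepDenom v t (n + 1 - l)
      = ∑ k ∈ Finset.range i, s (i - 1 - k) * t (k + n) := by
  have e : ∑ l ∈ Finset.range n, s (i + l) * stepDenom v t (n + 1 - l)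
      = - ∑ l ∈ Finset.range n, s (i + l) * t (n - 1 - l) := by
    rw [← Finset.sum_neg_distrib]
    refine Finset.sum_congr rfl fun l hl => ?_
    have := Finset.mem_range.1 hl
    rw [show n + 1 - l = (n - 1 - l) + 2 by omega, stepDenom]
    ring
  rw [Finset.sum_range_succ, Finset.sum_range_succ, e, h.column i n]
  simp only [Nat.sub_self, Nat.add_sub_cancel_left, stepDenom]
  ring

theorem sum_fin_ite_lt {n m : ℕ} (h : m ≤ n) (f : ℕ → R) :
    ∑ k : Fin n, (if (k : ℕ) < m then f k else 0) = ∑ k ∈ Finset.range m, f k := by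
  rw [Fin.sum_univ_eq_sum_range (fun k => if k < m then f k else 0), ← Finset.sum_filter]
  congr 1
  ext k
  simp only [Finset.mem_filter, Finset.mem_range]
  omega

/-- Unipotent column operations `T`, with the coefficients of `1 - v X - X² T`, turn every column
into a convolution with `s`. The lower triangular Toeplitz matrix `L` of `s` then factors out and
leaves `B` bordered by a `1`. -/
theorem hankelBorder_conv {v : R} {s t : ℕ → R} (h : JacobiStep v s t) (n : ℕ) (w : ℕ → R) :
    hankelBorder s (n + 1) (fun i => ∑ k ∈ Finset.range i, s (i - 1 - k) * w k)
      = s 0 ^ (n + 2) * hankelBorder t n w := by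
  let A : Matrix (Fin (n + 2)) (Fin (n + 2)) R := Matrix.of fun i j =>
    if j = Fin.last (n + 1) then ∑ k ∈ Finset.range i, s (i - 1 - k) * w k
    else s ((i : ℕ) + (j : ℕ))
  let T : Matrix (Fin (n + 2)) (Fin (n + 2)) R := Matrix.of fun l j =>
    if j = Fin.last (n + 1) then (if l = Fin.last (n + 1) then 1 else 0)
    else if (l : ℕ) ≤ j then stepDenom v t ((j : ℕ) - l) else 0
  let L : Matrix (Fin (n + 2)) (Fin (n + 2)) R := Matrix.of fun i j =>
    if (j : ℕ) ≤ i then s ((i : ℕ) - j) else 0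
  let B : Matrix (Fin (n + 1)) (Fin (n + 1)) R := Matrix.of fun i j =>
    if j = Fin.last n then w i else t ((i : ℕ) + (j : ℕ))
  let B' : Matrix (Fin (n + 2)) (Fin (n + 2)) R := Matrix.of
    (Fin.cons (Fin.cons 1 (fun _ => 0)) (fun i => Fin.cons 0 (B i)))
  have hT : T.det = 1 := by
    rw [Matrix.det_of_isUpperTriangular]
    · refine Finset.prod_eq_one fun i _ => ?_
      by_cases hi : i = Fin.last (n + 1) <;> simp [T, hi, stepDenom]
    · intro i j hij
      have hij' : (j : ℕ) < i := hij
      have hj : j ≠ Fin.last (n + 1) := by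
        rintro rfl
        have := i.2
        simp at hij'; omega
      simp [T, hj, not_le.2 (show j < i from hij)]
  have hL : L.det = s 0 ^ (n + 2) := by
    rw [Matrix.det_of_isLowerTriangular]
    · simp [L]
    · intro i j hij
      simp [L, not_le.2 (show i < j from hij)]
  have hB : B'.det = B.det := by
    rw [Matrix.det_succ_row_zero, Fin.sum_univ_succ]
    simp only [B', Matrix.of_apply, Fin.cons_zero, Fin.cons_succ]
    simp
    congr 1
  have hAT : A * T = L * B' := by
    ext i j
    have hA : ∀ j : Fin (n + 2), j ≠ Fin.last (n + 1) → (A * T) i j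
        = ∑ l ∈ Finset.range (j + 1), s (i + l) * stepDenom v t (j - l) := by
      intro j hj
      rw [← sum_fin_ite_lt (show (j : ℕ) + 1 ≤ n + 2 by omega), Matrix.mul_apply]
      refine Finset.sum_congr rfl fun l _ => ?_
      have hj' : (j : ℕ) < n + 1 := by
        have : (j : ℕ) ≠ n + 1 := fun e => hj (Fin.ext e)
        omega
      by_cases hl : (l : ℕ) ≤ j
      · have : l ≠ Fin.last (n + 1) := by
          rintro rfl
          simp at hl; omega
        simp [A, T, hj, this, Nat.lt_succ_of_le hl, show ¬ j < l from not_lt.2 hl]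
      · have : ¬ l ≤ j := hl
        simp [T, hj, this]
    have hlast : (A * T) i (Fin.last (n + 1))
        = ∑ k ∈ Finset.range i, s (i - 1 - k) * w k := by
      rw [Matrix.mul_apply, Finset.sum_eq_single (Fin.last (n + 1))]
      · simp [A, T]
      · intro l _ hl
        simp [T, hl]
      · simp
    have hR : ∀ j : Fin (n + 1), (L * B') i j.succ
        = ∑ k ∈ Finset.range i,
            s (i - 1 - k) * (if j = Fin.last n then w k else t (k + j)) := by
      intro j
      rw [Matrix.mul_apply, Fin.sum_univ_succ,
        ← sum_fin_ite_lt (show (i : ℕ) ≤ n + 1 by omega)]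
      simp only [B', L, B, Matrix.of_apply, Fin.cons_zero, Fin.cons_succ, Fin.val_succ, mul_zero,
        zero_add, ite_mul, zero_mul, Nat.add_one_le_iff]
      refine Finset.sum_congr rfl fun k _ => ?_
      rw [Nat.sub_sub, add_comm 1]
    refine Fin.cases ?_ (fun j => ?_) j
    · rw [hA _ (by simp [Fin.ext_iff]), Matrix.mul_apply, Fin.sum_univ_succ]
      simp [L, B', stepDenom]
    · rw [hR]
      by_cases hj : j = Fin.last n
      · subst hj
        simpa using hlast
      · have hj' : j.succ ≠ Fin.last (n + 1) := by
          rwa [← Fin.succ_last, Ne, Fin.succ_inj]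
        rw [hA _ hj']
        simp only [hj, if_false]
        exact h.sum_stepDenom i j
  have := congrArg Matrix.det hAT
  rw [Matrix.det_mul, Matrix.det_mul, hT, hL, hB, mul_one] at this
  exact this

/-- The sequence `x_0 = b`, `x_{n+1} = det (s_{i+j})_{i,j < n}`. -/
def hankelSeq (b : R) (s : ℕ → R) : ℕ → R
  | 0 => b
  | n + 1 => (hankelMatrix s n).det

/-- The sequence `y_0 = -c`, `y_1 = 0`, followed by the bordered Hankel determinants. -/
def borderSeq (c : R) (s : ℕ → R) : ℕ → R
  | 0 => -c
  | 1 => 0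
  | n + 2 => hankelBorder s n (fun i => s (i + (n + 1)))

theorem JacobiStep.hankelSeq_succ {v : R} {s t : ℕ → R} (h : JacobiStep v s t) (b : R) (n : ℕ) :
    hankelSeq b s (n + 1) = s 0 ^ n * hankelSeq 1 t n := by
  rcases n with - | - | n
  · simp [hankelSeq, hankelMatrix]
  · simp [hankelSeq, hankelMatrix]
  · simp only [hankelSeq]
    rw [← hankelBorder_self, ← hankelBorder_self, ← hankelBorder_conv h]
    -- The term `v * s (i + n)` is also a multiple of an earlier column, so it joins the sum that
    -- drops out.
    have : ∀ i, s (i + (n + 1)) = (∑ l ∈ Finset.range (n + 1), s (i + l) *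
        (if l = n then v else t (n - 1 - l)))
      + ∑ k ∈ Finset.range i, s (i - 1 - k) * t (k + n) := by
      intro i
      rw [h.column, Finset.sum_range_succ, if_pos rfl]
      rw [add_comm (v * _)]
      congr 1
      congr 1
      · refine Finset.sum_congr rfl fun l hl => ?_
        rw [if_neg (Finset.mem_range.1 hl).ne]
      · ring
    rw [funext this, hankelBorder_add, hankelBorder_columns s _ _ _ le_rfl, zero_add]

/-- Here the column multiplied by `v` is the regular last Hankel column, so it survives. At `n = 0`
the value `-v` of the sequence of `t` cancels it. -/
theorem JacobiStep.borderSeq_succ {v : R} {s t : ℕ → R} (h : JacobiStep v s t) (b c : R) (n : ℕ) :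
    borderSeq c s (n + 1) = v * hankelSeq b s (n + 1) + s 0 ^ n * borderSeq v t n := by
  rcases n with - | - | n
  · simp [hankelSeq, hankelMatrix, borderSeq]
  · simp [hankelSeq, hankelMatrix, borderSeq, hankelBorder, h 0]
  · simp only [hankelSeq, borderSeq]
    rw [← hankelBorder_self, ← hankelBorder_conv h, ← hankelBorder_smul,
      funext fun i => h.column i (n + 1), hankelBorder_add, hankelBorder_add,
      hankelBorder_columns s _ (fun l => t (n + 1 - 1 - l)) _ le_rfl, add_zero]

end Hankel

/-! ### The moment recursion as a quadratic equation -/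

section Moments

variable {R S K : Type*} [CommRing R] [CommRing S] [Field K]

/-- The moment recursion over a commutative ring. -/
def MomentRec (a b c : R) (s : ℕ → R) : Prop :=
  ∀ j : ℕ, 2 ≤ j →
    s j = a * s (j - 2)
      + b * ∑ i ∈ Finset.range (j - 1), s i * s (j - 2 - i)
      + c * ∑ i ∈ Finset.range (j - 2), s i * s (j - 3 - i)

/-- The solution of the moment recursion with prescribed `s_0` and `s_1`. -/
def momentSeq (a b c s₀ s₁ : R) : ℕ → R
  | 0 => s₀
  | 1 => s₁
  | n + 2 => a * momentSeq a b c s₀ s₁ n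
      + b * ∑ i : Fin (n + 1), momentSeq a b c s₀ s₁ i * momentSeq a b c s₀ s₁ (n - i)
      + c * ∑ i : Fin n, momentSeq a b c s₀ s₁ i * momentSeq a b c s₀ s₁ (n - 1 - i)
decreasing_by all_goals omega

theorem momentRec_momentSeq (a b c s₀ s₁ : R) : MomentRec a b c (momentSeq a b c s₀ s₁) := by
  intro j hj
  obtain ⟨n, rfl⟩ := Nat.exists_eq_add_of_le' hj
  rw [momentSeq,
    Fin.sum_univ_eq_sum_range (fun i => momentSeq a b c s₀ s₁ i * momentSeq a b c s₀ s₁ (n - i)),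
    Fin.sum_univ_eq_sum_range
      (fun i => momentSeq a b c s₀ s₁ i * momentSeq a b c s₀ s₁ (n - 1 - i))]
  rfl

theorem MomentRec.unique {a b c : R} {s t : ℕ → R} (hs : MomentRec a b c s)
    (ht : MomentRec a b c t) (h0 : s 0 = t 0) (h1 : s 1 = t 1) : s = t := by
  funext n
  induction n using Nat.strong_induction_on with
  | _ n ih =>
    by_cases hn : 2 ≤ n
    · rw [hs n hn, ht n hn, ih _ (by omega)]
      congr 2
      · congr 1
        refine Finset.sum_congr rfl fun i hi => ?_
        have := Finset.mem_range.1 hi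
        rw [ih _ (by omega), ih _ (by omega)]
      · refine Finset.sum_congr rfl fun i hi => ?_
        have := Finset.mem_range.1 hi
        rw [ih _ (by omega), ih _ (by omega)]
    · interval_cases n
      · exact h0
      · exact h1

theorem MomentRec.map {a b c : R} {s : ℕ → R} (hs : MomentRec a b c s) (φ : R →+* S) :
    MomentRec (φ a) (φ b) (φ c) (fun n => φ (s n)) := by
  intro j hj
  simp only [hs j hj, map_add, map_mul, map_sum]

open PowerSeries in
theorem momentRec_iff (a b c : R) (s : ℕ → R) :
    MomentRec a b c s ↔
      mk s = C (s 0) + C (s 1) * X + C a * (X ^ 2 * mk s)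
        + C b * (X ^ 2 * mk s ^ 2) + C c * (X ^ 3 * mk s ^ 2) := by
  have hsq : ∀ n, coeff n (mk s ^ 2) = ∑ i ∈ Finset.range (n + 1), s i * s (n - i) := by
    intro n
    rw [sq, coeff_mul, Finset.Nat.sum_antidiagonal_eq_sum_range_succ_mk]
    simp
  constructor
  · intro h
    ext n
    rcases n with - | - | - | n
    · simp
    · simp [coeff_X_pow_mul', coeff_C]
    · simp [coeff_X_pow_mul', hsq, h 2 le_rfl]
    · simp [coeff_X_pow_mul', hsq, h (n + 3) (by omega)]
  · intro h j hj
    obtain ⟨n, rfl⟩ := Nat.exists_eq_add_of_le' hj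
    have := congrArg (coeff (n + 2)) h
    rcases n with - | n
    · simpa [coeff_X_pow_mul', coeff_X, coeff_C, hsq] using this
    · simpa [coeff_X_pow_mul', coeff_X, coeff_C, hsq] using this

open PowerSeries in
theorem MomentRec.exists_step {a b c : K} {s : ℕ → K} (hs : MomentRec a b c s) (h0 : s 0 ≠ 0) :
    ∃ t, JacobiStep (s 1 / s 0) s t
      ∧ MomentRec (2 * (s 1 / s 0) ^ 2 - a) 1 (s 1 / s 0) t
      ∧ t 0 = a - (s 1 / s 0) ^ 2 + s 0 * b
      ∧ t 1 = s 0 * c - (s 1 / s 0) * (a - (s 1 / s 0) ^ 2) := by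
  set v := s 1 / s 0 with hv
  have hv' : s 1 = v * s 0 := by rw [hv]; field_simp
  set G : K⟦X⟧ := mk s with hG
  have hG0 : constantCoeff G ≠ 0 := by simpa [hG] using h0
  -- The choice `v = s_1 / s_0` is what removes the linear coefficient.
  have hdiv : X ^ 2 ∣ 1 - C v * X - C (s 0) * G⁻¹ := by
    have h2 : X ^ 2 ∣ (1 - C v * X) * G - C (s 0) := by
      rw [X_pow_dvd_iff]
      intro m hm
      interval_cases m
      · simp [hG, sub_mul]
      · have : coeff 1 (C v * X * G) = v * s 0 := by
          rw [mul_assoc, coeff_C_mul, show (1 : ℕ) = 0 + 1 from rfl, coeff_succ_X_mul]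
          simp [hG]
        rw [map_sub, sub_mul, map_sub, this]
        simp [hG, hv']
    have : 1 - C v * X - C (s 0) * G⁻¹ = ((1 - C v * X) * G - C (s 0)) * G⁻¹ := by
      rw [sub_mul, mul_assoc, PowerSeries.mul_inv_cancel _ hG0, mul_one]
    rw [this]
    exact h2.mul_right _
  obtain ⟨T, hT⟩ := hdiv
  have hGT : G * (1 - C v * X - X ^ 2 * T) = C (s 0) := by
    rw [← hT, sub_sub_cancel, mul_left_comm, PowerSeries.mul_inv_cancel _ hG0, mul_one]
  have hrec := (momentRec_iff a b c s).1 hs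
  rw [← hG, hv'] at hrec
  set t : ℕ → K := fun n => coeff n T with ht
  have hmk : mk t = T := by ext n; simp [ht]
  have hquad : T = C (a - v ^ 2 + s 0 * b) + C (s 0 * c - v * (a - v ^ 2)) * X
      + C (2 * v ^ 2 - a) * (X ^ 2 * T) + C 1 * (X ^ 2 * T ^ 2) + C v * (X ^ 3 * T ^ 2) := by
    have hC0 : (C (s 0) : K⟦X⟧) ≠ 0 := by simpa using h0
    have hX : (X : K⟦X⟧) ^ 2 ≠ 0 := pow_ne_zero _ X_ne_zero
    have key : C (s 0) * X ^ 2 * T = C (s 0) * X ^ 2 * (C (a - v ^ 2 + s 0 * b)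
        + C (s 0 * c - v * (a - v ^ 2)) * X
        + C (2 * v ^ 2 - a) * (X ^ 2 * T) + C 1 * (X ^ 2 * T ^ 2) + C v * (X ^ 3 * T ^ 2)) := by
      simp only [map_add, map_sub, map_mul, map_pow, map_one, map_ofNat] at hrec ⊢
      set D : K⟦X⟧ := 1 - C v * X - X ^ 2 * T with hD
      -- The quadratic equation times `D²`, with `G D = s_0` eliminating `G`.
      have e : C (s 0) * D = (C (s 0) + C v * C (s 0) * X) * D ^ 2 + C a * (X ^ 2 * C (s 0)) * D
          + (C b * X ^ 2 + C c * X ^ 3) * C (s 0) ^ 2 := by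
        linear_combination D ^ 2 * hrec
          + (-D + C a * X ^ 2 * D + (C b * X ^ 2 + C c * X ^ 3) * (G * D + C (s 0))) * hGT
      rw [hD] at e
      linear_combination e
    exact mul_left_cancel₀ (mul_ne_zero hC0 hX) key
  have hcoeff : ∀ p q r : K, T = C p + C q * X + C r * (X ^ 2 * T) + C 1 * (X ^ 2 * T ^ 2)
      + C v * (X ^ 3 * T ^ 2) → t 0 = p ∧ t 1 = q := by
    intro p q r h
    have e0 := congrArg (coeff 0) h
    have e1 := congrArg (coeff 1) h
    exact ⟨by simpa [ht] using e0, by simpa [coeff_X_pow_mul', coeff_C, ht] using e1⟩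
  obtain ⟨ht0, ht1⟩ := hcoeff _ _ _ hquad
  refine ⟨t, ?_, ?_, ht0, ht1⟩
  · intro m
    have hG' : G = C (s 0) + X * (C v * G + X * (T * G)) := by linear_combination hGT
    have := congrArg (coeff (m + 1)) hG'
    rw [map_add, coeff_succ_X_mul, map_add, coeff_C_mul, coeff_C, if_neg (by omega), zero_add] at this
    simp only [hG, coeff_mk] at this
    rw [this]
    congr 1
    rcases m with - | m
    · simp
    · rw [coeff_succ_X_mul, coeff_mul, Finset.Nat.sum_antidiagonal_eq_sum_range_succ_mk]
      refine Finset.sum_congr rfl fun k _ => ?_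
      simp [ht, mul_comm]
  · rw [momentRec_iff, hmk, ht0, ht1]
    exact hquad

end Moments

/-! ### Somos and shadow identities by descent -/

section Identities

variable {R S K : Type*} [CommRing R] [CommRing S] [Field K]

/-- The identities at the index `n` between a Somos-4 sequence `x` and its shadow `y`: the
Somos-4 relation, the shadow relation, the even and odd parts of the first integral `J = 2 h`, and
the two relations which amount to the map for `(v_n, d_n)`. -/
structure Identities (U F h : R) (x y : ℕ → R) (n : ℕ) : Prop where
  somos : x (n + 4) * x n = U ^ 2 * x (n + 3) * x (n + 1) + (U ^ 2 * F + h ^ 2) * x (n + 2) ^ 2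
  shadow : x n * y (n + 4) - U ^ 2 * x (n + 1) * y (n + 3)
    - 2 * (U ^ 2 * F + h ^ 2) * x (n + 2) * y (n + 2)
    - U ^ 2 * x (n + 3) * y (n + 1) + x (n + 4) * y n = 0
  integral : 2 * h * (x n * x (n + 1) * x (n + 2) * x (n + 3)) = x n ^ 2 * x (n + 3) ^ 2
    + U ^ 2 * (x (n + 1) ^ 3 * x (n + 3) + x n * x (n + 2) ^ 3)
    + (U ^ 2 * F + h ^ 2) * (x (n + 1) ^ 2 * x (n + 2) ^ 2)
  integral_odd : 2 * h * (y n * x (n + 1) * x (n + 2) * x (n + 3)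
      + x n * y (n + 1) * x (n + 2) * x (n + 3) + x n * x (n + 1) * y (n + 2) * x (n + 3)
      + x n * x (n + 1) * x (n + 2) * y (n + 3))
    = 2 * x n * y n * x (n + 3) ^ 2 + 2 * x n ^ 2 * x (n + 3) * y (n + 3)
    + U ^ 2 * (3 * x (n + 1) ^ 2 * y (n + 1) * x (n + 3) + x (n + 1) ^ 3 * y (n + 3)
      + y n * x (n + 2) ^ 3 + 3 * x n * x (n + 2) ^ 2 * y (n + 2))
    + (U ^ 2 * F + h ^ 2) * (2 * x (n + 1) * y (n + 1) * x (n + 2) ^ 2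
      + 2 * x (n + 1) ^ 2 * x (n + 2) * y (n + 2))
  linear : y n * x (n + 2) - y (n + 2) * x n = U * x (n + 1) ^ 2
  quadratic : x (n + 3) * x (n + 1) ^ 3 + x (n + 2) ^ 3 * x n
    + (y (n + 2) * x (n + 1) - y (n + 1) * x (n + 2)) ^ 2
    + F * x (n + 1) ^ 2 * x (n + 2) ^ 2 = 0

/-- Each relation is homogeneous in degree and in total index, which absorbs the powers of `r`.
Adding `v x` to `y` adds `2v` times the Somos relation to `shadow`, `4v` times `integral` to
`integral_odd`, and changes nothing else. -/
theorem Identities.gauge {U F h r v : R} {x y x' y' : ℕ → R} {n : ℕ}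
    (H : Identities U F h x' y' n) (hx : ∀ m, x (m + 1) = r ^ m * x' m)
    (hy : ∀ m, y (m + 1) = v * x (m + 1) + r ^ m * y' m) :
    Identities U F h x y (n + 1) := by
  have e1 : x (n + 1) = r ^ n * x' n := hx n
  have e2 : x (n + 1 + 1) = r ^ n * r * x' (n + 1) := by rw [hx, pow_succ]
  have e3 : x (n + 1 + 2) = r ^ n * r ^ 2 * x' (n + 2) := by rw [← pow_add, ← hx]
  have e4 : x (n + 1 + 3) = r ^ n * r ^ 3 * x' (n + 3) := by rw [← pow_add, ← hx]
  have e5 : x (n + 1 + 4) = r ^ n * r ^ 4 * x' (n + 4) := by rw [← pow_add, ← hx]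
  have f1 : y (n + 1) = r ^ n * (v * x' n + y' n) := by rw [hy, hx]; ring
  have f2 : y (n + 1 + 1) = r ^ n * r * (v * x' (n + 1) + y' (n + 1)) := by
    rw [hy, hx]; ring
  have f3 : y (n + 1 + 2) = r ^ n * r ^ 2 * (v * x' (n + 2) + y' (n + 2)) := by
    rw [← pow_add, show n + 1 + 2 = n + 2 + 1 by ring, hy, hx]; ring
  have f4 : y (n + 1 + 3) = r ^ n * r ^ 3 * (v * x' (n + 3) + y' (n + 3)) := by
    rw [← pow_add, show n + 1 + 3 = n + 3 + 1 by ring, hy, hx]; ring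
  have f5 : y (n + 1 + 4) = r ^ n * r ^ 4 * (v * x' (n + 4) + y' (n + 4)) := by
    rw [← pow_add, show n + 1 + 4 = n + 4 + 1 by ring, hy, hx]; ring
  generalize r ^ n = q at *
  constructor
  · rw [e1, e2, e3, e4, e5]
    linear_combination q ^ 2 * r ^ 4 * H.somos
  · rw [e1, e2, e3, e4, e5, f1, f2, f3, f4, f5]
    linear_combination q ^ 2 * r ^ 4 * (H.shadow + 2 * v * H.somos)
  · rw [e1, e2, e3, e4]
    linear_combination q ^ 4 * r ^ 6 * H.integral
  · rw [e1, e2, e3, e4, f1, f2, f3, f4]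
    linear_combination q ^ 4 * r ^ 6 * (H.integral_odd + 4 * v * H.integral)
  · rw [e1, e2, e3, f1, f3]
    linear_combination q ^ 2 * r ^ 2 * H.linear
  · rw [e1, e2, e3, e4, f2, f3]
    linear_combination q ^ 4 * r ^ 6 * H.quadratic

theorem Identities.map {U F h : R} {x y : ℕ → R} {n : ℕ} (H : Identities U F h x y n)
    (φ : R →+* S) :
    Identities (φ U) (φ F) (φ h) (fun m => φ (x m)) (fun m => φ (y m)) n where
  somos := by simpa [map_ofNat] using congrArg φ H.somos
  shadow := by simpa [map_ofNat] using congrArg φ H.shadow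
  integral := by simpa [map_ofNat] using congrArg φ H.integral
  integral_odd := by simpa [map_ofNat] using congrArg φ H.integral_odd
  linear := by simpa [map_ofNat] using congrArg φ H.linear
  quadratic := by simpa [map_ofNat] using congrArg φ H.quadratic

theorem Identities.of_map {U F h : R} {x y : ℕ → R} {n : ℕ} {φ : R →+* S}
    (hφ : Function.Injective φ)
    (H : Identities (φ U) (φ F) (φ h) (fun m => φ (x m)) (fun m => φ (y m)) n) :
    Identities U F h x y n where
  somos := hφ (by simpa [map_ofNat] using H.somos)
  shadow := hφ (by simpa [map_ofNat] using H.shadow)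
  integral := hφ (by simpa [map_ofNat] using H.integral)
  integral_odd := hφ (by simpa [map_ofNat] using H.integral_odd)
  linear := hφ (by simpa [map_ofNat] using H.linear)
  quadratic := hφ (by simpa [map_ofNat] using H.quadratic)

theorem MomentRec.identities_zero {a b c : R} {s : ℕ → R} (hs : MomentRec a b c s) :
    Identities (-(s 0 * c) - s 1 * b) (-a - 2 * s 0 * b)
      (s 0 * a * b + s 0 ^ 2 * b ^ 2 + s 1 * c) (hankelSeq b s) (borderSeq c s) 0 := by
  have h2 : s 2 = a * s 0 + b * s 0 ^ 2 := by
    rw [hs 2 le_rfl]; simp; ring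
  have h3 : s 3 = a * s 1 + b * (2 * s 0 * s 1) + c * s 0 ^ 2 := by
    rw [hs 3 (by omega)]; simp [Finset.sum_range_succ]; ring
  have h4 : s 4 = a * s 2 + b * (2 * s 0 * s 2 + s 1 ^ 2) + c * (2 * s 0 * s 1) := by
    rw [hs 4 (by omega)]; simp [Finset.sum_range_succ]; ring
  have h5 : s 5 = a * s 3 + b * (2 * s 0 * s 3 + 2 * s 1 * s 2)
      + c * (2 * s 0 * s 2 + s 1 ^ 2) := by
    rw [hs 5 (by omega)]; simp [Finset.sum_range_succ]; ring
  have x1 : hankelSeq b s 1 = 1 := by simp [hankelSeq]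
  have x2 : hankelSeq b s 2 = s 0 := by simp [hankelSeq, hankelMatrix]
  have x3 : hankelSeq b s 3 = s 0 * s 2 - s 1 ^ 2 := by
    simp [hankelSeq, hankelMatrix, Matrix.det_fin_two]; ring
  have x4 : hankelSeq b s 4 = s 0 * (s 2 * s 4 - s 3 ^ 2) - s 1 * (s 1 * s 4 - s 2 * s 3)
      + s 2 * (s 1 * s 3 - s 2 ^ 2) := by
    simp [hankelSeq, hankelMatrix, Matrix.det_fin_three]; ring
  have y2 : borderSeq c s 2 = s 1 := by simp [borderSeq, hankelBorder]
  have y3 : borderSeq c s 3 = s 0 * s 3 - s 1 * s 2 := by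
    simp [borderSeq, hankelBorder, Matrix.det_fin_two, Fin.ext_iff]; ring
  have y4 : borderSeq c s 4 = s 0 * (s 2 * s 5 - s 3 * s 4) - s 1 * (s 1 * s 5 - s 2 * s 4)
      + s 3 * (s 1 * s 3 - s 2 ^ 2) := by
    simp [borderSeq, hankelBorder, Matrix.det_fin_three, Fin.ext_iff]; ring
  constructor <;> simp only [zero_add, x1, x2, x3, x4, y2, y3, y4, h5, h4, h3, h2,
    show hankelSeq b s 0 = b from rfl, show borderSeq c s 0 = -c from rfl,
    show borderSeq c s 1 = 0 from rfl] <;> ring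

/-- The induction runs over all parameters at once, since each step changes them while preserving
`U`, `F` and `h`. -/
theorem MomentRec.identities_of_ne_zero (n : ℕ) : ∀ {a b c : K} {s : ℕ → K},
    MomentRec a b c s → (∀ m, (hankelMatrix s m).det ≠ 0) →
    Identities (-(s 0 * c) - s 1 * b) (-a - 2 * s 0 * b)
      (s 0 * a * b + s 0 ^ 2 * b ^ 2 + s 1 * c) (hankelSeq b s) (borderSeq c s) n := by
  induction n with
  | zero => exact fun hs _ => hs.identities_zero
  | succ n ih =>
    intro a b c s hs hne
    have h0 : s 0 ≠ 0 := by simpa [hankelMatrix] using hne 1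
    obtain ⟨t, hst, ht, t0, t1⟩ := hs.exists_step h0
    have hv : s 1 = s 1 / s 0 * s 0 := by field_simp
    set v := s 1 / s 0
    have := (ih ht fun m hm => hne (m + 1) ?_).gauge (hst.hankelSeq_succ b)
      (hst.borderSeq_succ b c)
    · rw [t0, t1] at this
      rw [hv]
      convert this using 1 <;> ring
    · have := hst.hankelSeq_succ b (m + 1)
      simpa [hankelSeq, hm] using this

theorem map_hankelSeq (φ : R →+* S) (b : R) (s : ℕ → R) (n : ℕ) :
    φ (hankelSeq b s n) = hankelSeq (φ b) (fun m => φ (s m)) n := by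
  cases n with
  | zero => rfl
  | succ n =>
    simp only [hankelSeq, RingHom.map_det]
    rfl

theorem map_borderSeq (φ : R →+* S) (c : R) (s : ℕ → R) (n : ℕ) :
    φ (borderSeq c s n) = borderSeq (φ c) (fun m => φ (s m)) n := by
  rcases n with - | - | n
  · simp [borderSeq]
  · simp [borderSeq]
  · simp only [borderSeq, hankelBorder, RingHom.map_det]
    congr 1
    ext i j
    by_cases h : j = Fin.last n <;> simp [h]

/-- These moments (Catalan numbers interlaced with zeros) are a fixed point of the continued
fraction step. -/
theorem MomentRec.hankelMatrix_det_eq_one (n : ℕ) : ∀ {s : ℕ → K}, MomentRec 0 1 0 s →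
    s 0 = 1 → s 1 = 0 → (hankelMatrix s n).det = 1 := by
  induction n with
  | zero => simp
  | succ n ih =>
    intro s hs h0 h1
    obtain ⟨t, hst, ht, t0, t1⟩ := hs.exists_step (by simp [h0])
    simp only [h0, h1] at ht t0 t1
    have := hst.hankelSeq_succ 1 (n + 1)
    rw [h0, one_pow, one_mul] at this
    exact this.trans (ih (by simpa using ht) (by simpa using t0) (by simpa using t1))

open Polynomial in
/-- The identities hold for all moment sequences over a field, since the Hankel determinants do not
vanish identically on the line which joins the parameters to those of the Catalan numbers. -/
theorem MomentRec.identities {a b c : K} {s : ℕ → K} (hs : MomentRec a b c s) (n : ℕ) :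
    Identities (-(s 0 * c) - s 1 * b) (-a - 2 * s 0 * b)
      (s 0 * a * b + s 0 ^ 2 * b ^ 2 + s 1 * c) (hankelSeq b s) (borderSeq c s) n := by
  let line : K → K → K[X] := fun p q => C p + X * C (q - p)
  have line0 : ∀ p q, evalRingHom 0 (line p q) = p := by simp [line]
  have line1 : ∀ p q, evalRingHom 1 (line p q) = q := by simp [line]
  set A := line a 0
  set B := line b 1
  set D := line c 0
  set S := momentSeq A B D (line (s 0) 1) (line (s 1) 0) with hS
  have hrec : MomentRec A B D S := momentRec_momentSeq _ _ _ _ _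
  have S0 : S 0 = line (s 0) 1 := by rw [hS, momentSeq]
  have S1 : S 1 = line (s 1) 0 := by rw [hS, momentSeq]
  have hne : ∀ m, (hankelMatrix S m).det ≠ 0 := by
    intro m hm
    have h1 := hrec.map (evalRingHom (1 : K))
    rw [line1, line1, line1] at h1
    have := h1.hankelMatrix_det_eq_one m (by rw [S0, line1]) (by rw [S1, line1])
    have e := map_hankelSeq (evalRingHom (1 : K)) B S (m + 1)
    simp only [hankelSeq] at e
    rw [hm, map_zero, this] at e
    exact zero_ne_one e
  -- The descent divides by `s_0`, so it is run over the fraction field and the identities are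
  -- pulled back to `K[X]`.
  let ι := algebraMap K[X] (FractionRing K[X])
  have hι : Function.Injective ι := IsFractionRing.injective _ _
  have hK := (hrec.map ι).identities_of_ne_zero n (fun m hm => hne m (hι (by
    rw [map_zero, ← hm, RingHom.map_det]; rfl)))
  have hR : Identities (-(S 0 * D) - S 1 * B) (-A - 2 * S 0 * B)
      (S 0 * A * B + S 0 ^ 2 * B ^ 2 + S 1 * D) (hankelSeq B S) (borderSeq D S) n := by
    refine Identities.of_map hι ?_
    simp only [map_hankelSeq, map_borderSeq]
    simpa [map_ofNat] using hK
  have hC := hR.map (evalRingHom (0 : K))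
  have h0 := hrec.map (evalRingHom (0 : K))
  rw [line0, line0, line0] at h0
  have hseq : (fun m => evalRingHom (0 : K) (S m)) = s :=
    h0.unique hs (by rw [S0, line0]) (by rw [S1, line0])
  simp only [map_hankelSeq, map_borderSeq] at hC
  simp only [map_sub, map_neg, map_add, map_mul, map_pow, map_ofNat] at hC
  rw [hseq, line0, line0, line0, S0, S1, line0, line0] at hC
  exact hC

end Identities

/-! ### The third shadow sequence and linear independence -/

section Consequences

theorem Identities.firstIntegralAt_dual {U F h : ℂ} {x y : ℕ → ℂ} {n : ℕ}
    (H : Identities U F h x y n) :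
    FirstIntegralAt (U ^ 2) (U ^ 2 * F + h ^ 2) (2 * h) (fun m => dual (x m) (y m)) n := by
  have hd : ∀ p q p' q' : ℂ, dual p q * dual p' q' = dual (p * p') (p * q' + q * p') := by
    intro p q p' q'
    ext <;> simp [dual]
  have hadd : ∀ p q p' q' : ℂ, dual p q + dual p' q' = dual (p + p') (q + q') := by
    intro p q p' q'
    ext <;> simp [dual]
  have halg : ∀ p : ℂ, algebraMap ℂ (DualNumber ℂ) p = dual p 0 := by
    intro p
    ext <;> simp [dual, TrivSqZeroExt.algebraMap_eq_inl]
  simp only [FirstIntegralAt, pow_succ, pow_zero, one_mul, hd, hadd, halg]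
  congr 1
  · linear_combination H.integral
  · linear_combination H.integral_odd

/-- The sequence `v_n` with `y_{n+1} / x_{n+1} = y_n / x_n - v_n`. -/
noncomputable def canonicalV (x y : ℕ → ℂ) (n : ℕ) : ℂ := y n / x n - y (n + 1) / x (n + 1)

/-- The sum telescopes, and `y_1 = 0` makes `v_0 = y_0 / x_0`. -/
theorem thirdShadow_canonicalV {x y : ℕ → ℂ} (hx : ∀ n, x n ≠ 0) (hy : y 1 = 0) (n : ℕ) :
    thirdShadow x (canonicalV x y) n + canonicalV x y 0 * x n = y n := by
  have h : ∑ j ∈ Finset.range n, canonicalV x y j = y 0 / x 0 - y n / x n :=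
    Finset.sum_range_sub' (fun j => y j / x j) n
  rw [thirdShadow, h, canonicalV, hy]
  have := hx n
  field_simp
  ring

theorem associatedSolution_canonicalV {U F h : ℂ} {x y : ℕ → ℂ} (hx : ∀ n, x n ≠ 0)
    (H : ∀ n, Identities U F h x y n) :
    AssociatedSolution U F x (canonicalV x y) (fun n => x (n + 1) * x (n - 1) / x n ^ 2) where
  d_eq _ _ := rfl
  v_eq n hn := by
    obtain ⟨n, rfl⟩ := Nat.exists_eq_add_of_le' hn
    change y (n + 1) / x (n + 1) - y (n + 2) / x (n + 2)
      = -(y n / x n - y (n + 1) / x (n + 1)) + U / (x (n + 2) * x n / x (n + 1) ^ 2)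
    have h0 := hx n
    have h1 := hx (n + 1)
    have h2 := hx (n + 2)
    have := (H n).linear
    field_simp
    linear_combination x (n + 1) * this
  d_succ n hn := by
    obtain ⟨n, rfl⟩ := Nat.exists_eq_add_of_le' hn
    change x (n + 3) * x (n + 1) / x (n + 2) ^ 2 = -(x (n + 2) * x n / x (n + 1) ^ 2)
      - (y (n + 1) / x (n + 1) - y (n + 2) / x (n + 2)) ^ 2 - F
    have h0 := hx n
    have h1 := hx (n + 1)
    have h2 := hx (n + 2)
    have := (H n).quadratic
    field_simp
    linear_combination this

/-- Two associated solutions whose parameters have the same square agree up to sign. -/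
theorem AssociatedSolution.eq_or_eq_neg {u U F : ℂ} {x v w d e : ℕ → ℂ} (hx : ∀ n, x n ≠ 0)
    (hu : u ^ 2 = U ^ 2) (hv : AssociatedSolution u F x v d)
    (hw : AssociatedSolution U F x w e) :
    ∃ σ : ℂ, (σ = 1 ∨ σ = -1) ∧ u = σ * U ∧ ∀ n, v n = σ * w n := by
  have hde : ∀ n, 1 ≤ n → d n = e n := fun n hn => by rw [hv.d_eq n hn, hw.d_eq n hn]
  have hd0 : ∀ n, 1 ≤ n → e n ≠ 0 := fun n hn => by
    rw [hw.d_eq n hn]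
    exact div_ne_zero (mul_ne_zero (hx _) (hx _)) (pow_ne_zero _ (hx _))
  -- Both solutions share `d`, which determines the squares `v_n²`.
  have hsq : v 1 ^ 2 = w 1 ^ 2 := by
    have h1 := hv.d_succ 1 le_rfl
    have h2 := hw.d_succ 1 le_rfl
    rw [hde 1 le_rfl, hde 2 (by norm_num)] at h1
    linear_combination h1 - h2
  suffices ∃ σ : ℂ, (σ = 1 ∨ σ = -1) ∧ u = σ * U ∧ v 0 = σ * w 0 by
    obtain ⟨σ, hσ, hu, h0⟩ := this
    refine ⟨σ, hσ, hu, fun n => ?_⟩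
    induction n with
    | zero => exact h0
    | succ n ih =>
      rw [hv.v_eq (n + 1) (by omega), hw.v_eq (n + 1) (by omega), hde _ (by omega),
        Nat.add_sub_cancel, ih, hu]
      ring
  have hv1 := hv.v_eq 1 le_rfl
  have hw1 := hw.v_eq 1 le_rfl
  rw [hde 1 le_rfl] at hv1
  simp only [Nat.sub_self] at hv1 hw1
  obtain ⟨σ, hσ, hσu⟩ : ∃ σ : ℂ, (σ = 1 ∨ σ = -1) ∧ u = σ * U := by
    rcases sq_eq_sq_iff_eq_or_eq_neg.1 hu with h | h
    · exact ⟨1, Or.inl rfl, by rw [h, one_mul]⟩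
    · exact ⟨-1, Or.inr rfl, by rw [h, neg_one_mul]⟩
  have hσ2 : σ ^ 2 = 1 := by rcases hσ with rfl | rfl <;> norm_num
  -- If `U = 0`, the sign is not fixed by `u = σ U` and is read off from `v_0`. Otherwise, comparing
  -- squares at two consecutive indices forces `v_1 = σ w_1`.
  by_cases hU : U = 0
  · have hu0 : u = 0 := by rw [hσu, hU, mul_zero]
    rw [hu0, zero_div, add_zero] at hv1
    rw [hU, zero_div, add_zero] at hw1
    rw [hv1, hw1, neg_sq, neg_sq] at hsq
    rcases sq_eq_sq_iff_eq_or_eq_neg.1 hsq with h | h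
    · exact ⟨1, Or.inl rfl, by rw [hu0, hU, mul_zero], by rw [h, one_mul]⟩
    · exact ⟨-1, Or.inr rfl, by rw [hu0, hU, mul_zero], by rw [h, neg_one_mul]⟩
  · refine ⟨σ, hσ, hσu, ?_⟩
    have hv2 := hv.v_eq 2 (by norm_num)
    have hw2 := hw.v_eq 2 (by norm_num)
    rw [hde 2 (by norm_num)] at hv2
    simp only [Nat.add_one_sub_one] at hv2 hw2
    have hsq2 : v 2 ^ 2 = w 2 ^ 2 := by
      have h1 := hv.d_succ 2 (by norm_num)
      have h2 := hw.d_succ 2 (by norm_num)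
      rw [hde 2 (by norm_num), hde 3 (by norm_num)] at h1
      linear_combination h1 - h2
    have hq : U / e 2 ≠ 0 := div_ne_zero hU (hd0 2 (by norm_num))
    have hv2' : v 2 = -v 1 + σ * (U / e 2) := by rw [hv2, hσu, mul_div_assoc]
    have key : U / e 2 * (w 1 - σ * v 1) = 0 := by
      rw [hv2', hw2] at hsq2
      have h2 : (2 : ℂ) * (U / e 2 * (w 1 - σ * v 1)) = 0 := by
        linear_combination hsq2 - hsq - (U / e 2) ^ 2 * hσ2
      simpa using h2
    have h1 : w 1 = σ * v 1 := by
      simpa [hq, sub_eq_zero] using key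
    rw [hv1, hw1, hσu] at h1
    rw [mul_div_assoc] at h1
    linear_combination σ * h1 + (σ * (U / e 1) - v 0) * hσ2

theorem thirdShadow_smul (x w : ℕ → ℂ) (σ : ℂ) (n : ℕ) :
    thirdShadow x (fun j => σ * w j) n = σ * thirdShadow x w n := by
  simp only [thirdShadow, ← Finset.mul_sum]
  ring

/-- A dependence involving `y` forces `s_0 y_n = (n - 1) s_1 x_n`, because `y_1 = 0` and `y_2 =
s_1`. For `n = 3, 4` this and the relations `linear` and `quadratic` give `x_3 = s_0³ b` and then
the excluded case. -/
theorem MomentRec.linearIndependent {a b c : ℂ} {s : ℕ → ℂ} (hs : MomentRec a b c s)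
    (hc : c ≠ 0) (h0 : s 0 ≠ 0)
    {x y : ℕ → ℂ} (hx : x = hankelSeq b s) (hy : ∀ n, 1 ≤ n → y n = borderSeq c s n)
    (hx3 : x 3 ≠ 0)
    (hne : ¬ (s 0 * c = s 1 * b ∧ s 0 ^ 2 * a = s 1 ^ 2)) :
    LinearIndependent ℂ
      ![fun k : ℕ => x (k + 1), fun k : ℕ => ((k : ℂ) + 1) * x (k + 1),
        fun k : ℕ => y (k + 1)] := by
  have x1 : x 1 = 1 := by simp [hx, hankelSeq]
  have x2 : x 2 = s 0 := by simp [hx, hankelSeq, hankelMatrix]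
  have y1 : y 1 = 0 := hy 1 le_rfl
  have y2 : y 2 = s 1 := by simp [hy, borderSeq, hankelBorder]
  have x0 : x 0 = b := by simp [hx, hankelSeq]
  have l1 := (hs.identities 1).linear
  have l2 := (hs.identities 2).linear
  have q0 := (hs.identities 0).quadratic
  have q1 := (hs.identities 1).quadratic
  simp only [zero_add, Nat.reduceAdd, ← hx, ← hy 1 le_rfl, ← hy 2 (by norm_num),
    ← hy 3 (by norm_num), ← hy 4 (by norm_num), x0, x1, x2, y1, y2] at l1 l2 q0 q1
  rw [Fintype.linearIndependent_iff]
  intro g hg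
  rw [Fin.sum_univ_three] at hg
  simp only [Matrix.cons_val_zero, Matrix.cons_val_one, Matrix.cons_val_two] at hg
  have e1 : g 0 + g 1 = 0 := by simpa [x1, y1] using congrFun hg 0
  have e2 : g 0 * s 0 + g 1 * (2 * s 0) + g 2 * s 1 = 0 := by
    have := congrFun hg 1
    norm_num [x2, y2] at this
    linear_combination this
  have e3 : g 0 * x 3 + g 1 * (3 * x 3) + g 2 * y 3 = 0 := by
    have := congrFun hg 2
    norm_num at this
    linear_combination this
  have e4 : g 0 * x 4 + g 1 * (4 * x 4) + g 2 * y 4 = 0 := by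
    have := congrFun hg 3
    norm_num at this
    linear_combination this
  have hg2 : g 2 = 0 := by
    by_contra hg2
    refine hne ?_
    have y3 : s 0 * y 3 = 2 * s 1 * x 3 := mul_left_cancel₀ hg2 (by
      linear_combination s 0 * e3 - 2 * x 3 * e2 + (s 0 * x 3) * e1)
    have y4 : s 0 * y 4 = 3 * s 1 * x 4 := mul_left_cancel₀ hg2 (by
      linear_combination s 0 * e4 - 3 * x 4 * e2 + (2 * s 0 * x 4) * e1)
    set U := -(s 0 * c) - s 1 * b with hU
    have hA : -(2 * s 1 * x 3) = U * s 0 ^ 3 := by linear_combination s 0 * l1 + y3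
    have hB : -(2 * s 1 * x 4) = U * x 3 ^ 2 := by linear_combination l2 + y4
    have hU0 : U ≠ 0 := by
      intro h
      have hs1 : s 1 = 0 := by simpa [h, hx3] using hA
      rw [hU, hs1] at h
      simp [h0, hc] at h
    have hC : x 3 ^ 3 = s 0 ^ 3 * x 4 := mul_left_cancel₀ hU0 (by
      linear_combination x 4 * hA - x 3 * hB)
    have hE : 2 * x 3 + s 1 ^ 2 + (-a - 2 * s 0 * b) * s 0 ^ 2 = 0 := by
      refine mul_left_cancel₀ (pow_ne_zero 2 hx3) ?_
      linear_combination q1 + hC - s 0 * y 3 * y3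
    have hF : x 3 = s 0 ^ 3 * b := by linear_combination hE - q0
    constructor
    · refine mul_left_cancel₀ (pow_ne_zero 3 h0) ?_
      linear_combination hA + 2 * s 1 * hF
    · linear_combination 2 * hF - hE
  have hg1 : g 1 = 0 := by
    have : g 1 * s 0 = 0 := by linear_combination e2 - s 0 * e1 - s 1 * hg2
    exact (mul_eq_zero.1 this).resolve_right h0
  have hg0 : g 0 = 0 := by linear_combination e1 - hg1
  intro i
  fin_cases i
  · exact hg0
  · exact hg1
  · exact hg2

end Consequences

end ShadowSomos

theorem mainTheorem8 (a b c : ℂ) (s : ℕ → ℂ)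
    (ha : a ≠ 0) (hb : b ≠ 0) (hc : c ≠ 0) (hs0 : s 0 ≠ 0)
    (hs : ShadowSomos.MomentRecursion a b c s)
    (U F J α β : ℂ) (x y : ℕ → ℂ)
    (hU : U = ShadowSomos.paramU b c s) (hF : F = ShadowSomos.paramF a b s)
    (hJ : J = ShadowSomos.paramJ a b c s)
    (hα : α = ShadowSomos.paramAlpha b c s) (hβ : β = ShadowSomos.paramBeta a b c s)
    (hx : x = ShadowSomos.somosSeq b s)
    (hy : ∀ n, 1 ≤ n → y n = ShadowSomos.borderedHankelDet s (n - 1)) :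
    -- the Hankel determinants form a Somos-4 sequence
    (∀ n, ShadowSomos.SomosAt α β x n) ∧
    -- the bordered Hankel determinants form a shadow Somos-4 sequence
    (∀ n, 1 ≤ n → ShadowSomos.ShadowAt α β x y n) ∧
    -- along which the first integral `J` does not vary
    (∀ n, 1 ≤ n →
      ShadowSomos.FirstIntegralAt α β J (fun m => ShadowSomos.dual (x m) (y m)) n) ∧
    -- it is the third shadow sequence, up to a multiple of `x_n` (and to the sign of `u = ± U`)
    ((∀ n, x n ≠ 0) →
      (∃ v d : ℕ → ℂ, ShadowSomos.AssociatedSolution U F x v d ∧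
        ∀ n, 1 ≤ n → y n = ShadowSomos.thirdShadow x v n + v 0 * x n) ∧
      (∀ (u : ℂ) (v d : ℕ → ℂ), u ^ 2 = α → ShadowSomos.AssociatedSolution u F x v d →
        ∃ σ : ℂ, (σ = 1 ∨ σ = -1) ∧ u = σ * U ∧
          ∀ n, 1 ≤ n → y n = σ * (ShadowSomos.thirdShadow x v n + v 0 * x n))) ∧
    -- it is independent of the first two shadow sequences `x_n` and `n x_n`
    (x 2 ≠ 0 → x 3 ≠ 0 → x 4 ≠ 0 → ¬ (s 0 * c = s 1 * b ∧ s 0 ^ 2 * a = s 1 ^ 2) →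
      LinearIndependent ℂ
        ![fun k : ℕ => x (k + 1), fun k : ℕ => ((k : ℂ) + 1) * x (k + 1),
          fun k : ℕ => y (k + 1)]) := by
  have hrec : ShadowSomos.MomentRec a b c s := hs
  have hx' : x = ShadowSomos.hankelSeq b s := by
    rw [hx]
    funext n
    cases n <;> rfl
  have hy' : ∀ n, 1 ≤ n → y n = ShadowSomos.borderSeq c s n := by
    intro n hn
    rw [hy n hn]
    obtain ⟨n, rfl⟩ := Nat.exists_eq_add_of_le' hn
    cases n <;> rfl
  -- The value `y 0` is arbitrary, whereas `z 0 = -c` makes the identities valid from `n = 0` on;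
  -- the solution built from `z` therefore has `v_0 = -c / b`.
  set z := ShadowSomos.borderSeq c s with hz
  have hU' : U = -(s 0 * c) - s 1 * b := hU
  have hF' : F = -a - 2 * s 0 * b := hF
  obtain ⟨h, hh⟩ : ∃ h, h = s 0 * a * b + s 0 ^ 2 * b ^ 2 + s 1 * c := ⟨_, rfl⟩
  have hJ' : J = 2 * h := by rw [hJ, hh]; rfl
  have hα' : α = U ^ 2 := by rw [hα, hU]; rfl
  have hβ' : β = U ^ 2 * F + h ^ 2 := by
    rw [hβ, ShadowSomos.paramBeta, ← hα, ← hF, ← hJ, hα', hJ']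
    ring
  have H : ∀ n, ShadowSomos.Identities U F h x z n := by
    intro n
    rw [hU', hF', hh, hx', hz]
    exact hrec.identities n
  refine ⟨fun n => ?_, fun n hn => ?_, fun n hn => ?_, fun hne => ⟨?_, ?_⟩, fun _ h3 _ hne => ?_⟩
  · rw [hα', hβ']
    exact (H n).somos
  · rw [ShadowSomos.ShadowAt, hy' n hn, hy' _ (by omega), hy' _ (by omega), hy' _ (by omega),
      hy' _ (by omega), hα', hβ']
    exact (H n).shadow
  · have := (H n).firstIntegralAt_dual
    rw [hα', hβ', hJ']
    simpa only [ShadowSomos.FirstIntegralAt, hy' n hn, hy' (n + 1) (by omega),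
      hy' (n + 2) (by omega), hy' (n + 3) (by omega)] using this
  · refine ⟨_, _, ShadowSomos.associatedSolution_canonicalV hne H, fun n hn => ?_⟩
    rw [ShadowSomos.thirdShadow_canonicalV hne rfl, hy' n hn]
  · intro u v d hu hv
    obtain ⟨σ, hσ, huU, hvw⟩ := hv.eq_or_eq_neg hne (hu.trans hα')
      (ShadowSomos.associatedSolution_canonicalV hne H)
    refine ⟨σ, hσ, huU, fun n hn => ?_⟩
    have hσ2 : σ ^ 2 = 1 := by rcases hσ with rfl | rfl <;> norm_num
    rw [funext hvw, ShadowSomos.thirdShadow_smul, hy' n hn,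
      ← ShadowSomos.thirdShadow_canonicalV hne (show z 1 = 0 from rfl) n]
    linear_combination -(ShadowSomos.thirdShadow x (ShadowSomos.canonicalV x z) n
      + ShadowSomos.canonicalV x z 0 * x n) * hσ2
  · exact hrec.linearIndependent hc hs0 hx' hy' h3 hne
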